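/- Fix an integer $m\ge 1$. Let $G_n^m$ be the preferential attachment random multigraph, defined inductively: $G_1^m$ is a single vertex with $m$ self-loops, and $G_n^m$ is obtained from $G_{n-1}^m$ by adding a new node $u$ (which joins at time $n$) and then inserting $m$ edges $(u,v_1),\dots,(u,v_m)$ one after the other; if $M_i$ is the sum of the degrees of all nodes just before the $i$-th of these edges is inserted, then, given the current multigraph, $v_i$ equals a node $v\ne u$ with probability $\frac{\deg(v)}{M_i+1}$ and equals $u$ with probability $\frac{\deg(u)+1}{M_i+1}$, where degrees are the current ones and a self-loop contributes $2$ to the degree of its node. Then, with probability tending to $1$ as $n\to\infty$, every node of $G_n^m$ that joined before time $n^{0.3}$ has degree at least $\log^3 n = (\ln n)^3$ in $G_n^m$. -/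

import Mathlib

open Filter Topology

noncomputable section

/-- A finite multigraph (parallel edges and loops allowed) on the vertex set `V`, given by its
multiset of unoriented edges. The element `s(v, v)` of `Sym2 V` is a loop at `v`. -/
abbrev Multigraph (V : Type) : Type := Multiset (Sym2 V)

namespace Multigraph

variable {V : Type} [DecidableEq V]

/-- The degree of `v`: the number of edges incident with `v`, where a loop at `v` is counted
twice. -/
def degree (G : Multigraph V) (v : V) : ℕ :=
  G.countP (fun e => v ∈ e) + G.count s(v, v)

variable [Fintype V]

/-- The sum of the degrees of all the nodes. -/
def degreeSum (G : Multigraph V) : ℕ := ∑ v, G.degree v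

/-- The law of the random endpoint of an edge that is inserted at the new node `u` when the
current multigraph is `G`: with `M` the current degree sum, a node `v ≠ u` is chosen with
probability `deg v / (M + 1)`, and `u` itself with probability `(deg u + 1) / (M + 1)`. -/
def endpointLaw (G : Multigraph V) (u : V) : PMF V :=
  PMF.ofFintype
    (fun v => ((if v = u then G.degree v + 1 else G.degree v : ℕ) : ENNReal) /
      ((G.degreeSum + 1 : ℕ) : ENNReal))
    (by
      have h : ∑ v, (if v = u then G.degree v + 1 else G.degree v) = G.degreeSum + 1 := by
        have h' : ∀ v, (if v = u then G.degree v + 1 else G.degree v)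
            = G.degree v + (if v = u then 1 else 0) := by
          intro v; split_ifs <;> rfl
        simp [h', Finset.sum_add_distrib, degreeSum]
      simp only [div_eq_mul_inv]
      rw [← Finset.sum_mul, ← Nat.cast_sum, h]
      exact ENNReal.mul_inv_cancel (Nat.cast_ne_zero.mpr (Nat.succ_ne_zero G.degreeSum))
        (ENNReal.natCast_ne_top _))

/-- Insert one random edge at `u`. -/
def attachEdge (u : V) (G : Multigraph V) : PMF (Multigraph V) :=
  (G.endpointLaw u).map (fun v => s(u, v) ::ₘ G)

/-- Insert `k` random edges at `u`, one after the other, the degrees being updated after each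
insertion. -/
def attachEdges (u : V) : ℕ → Multigraph V → PMF (Multigraph V)
  | 0, G => PMF.pure G
  | k + 1, G => (attachEdges u k G).bind (attachEdge u)

end Multigraph

/-- The law of the preferential attachment graph `G_n^m`. The vertex set is `Fin n`, and the node
that joins at time `t` (for `1 ≤ t ≤ n`) has the label `t - 1`. `G_1^m` is a single vertex with
`m` loops, and `G_{n+1}^m` arises from `G_n^m` by adding a new node and then `m` random edges at
this node. (The value at `n = 0` is the empty graph, by convention.) -/
def paGraph (m : ℕ) : (n : ℕ) → PMF (Multigraph (Fin n))
  | 0 => PMF.pure 0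
  | 1 => PMF.pure (Multiset.replicate m s(0, 0))
  | n + 2 => (paGraph m (n + 1)).bind fun G =>
      Multigraph.attachEdges (Fin.last (n + 1)) m (G.map (Sym2.map Fin.castSucc))

/-- The time at which a node of `G_n^m` joins the network. -/
def joinTime {n : ℕ} (v : Fin n) : ℕ := (v : ℕ) + 1

end

/-! An early node is unlikely to stay poor because a decreasing function of its degree contracts in
expectation. If f(d+1) = f(d)(1 - c/d), an edge insertion that picks a given old node with
probability d/M multiplies the expected f by exactly 1 - c/M, whatever d is
(`expect_attachEdge_le`). As M is at most about 2mt at time t, the m insertions contribute at most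
about exp(-c/(2t)), so the expectation for a node that joined at time i is of order (i/n)^(c/2)
(`expect_paGraph_degreePotential_le`). Since f(d) ≥ 1/(10d), Markov's inequality bounds the
probability of a degree below L (`paGraph_degree_lt_le`), and a union bound covers the early nodes.
The constant c = 9/10 is below 1, so that f stays positive after d = 1, and above 6/7, so that the
union bound exponent 0.3 - 0.7c/2 = -0.015 is negative. -/

noncomputable section

/-! ### Expectations under a `PMF` -/

namespace PMF

variable {α β : Type}

/-- The expectation of a nonnegative extended real function under a `PMF`. -/
def expect (p : PMF α) (F : α → ENNReal) : ENNReal := ∑' a, p a * F a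

theorem expect_pure (a : α) (F : α → ENNReal) : (PMF.pure a).expect F = F a := by
  unfold expect
  rw [tsum_eq_single a]
  · simp
  · intro b hb
    simp [hb]

theorem expect_bind (p : PMF α) (q : α → PMF β) (F : β → ENNReal) :
    (p.bind q).expect F = p.expect fun a => (q a).expect F := by
  unfold expect
  simp only [PMF.bind_apply, ← ENNReal.tsum_mul_right, ← ENNReal.tsum_mul_left]
  rw [ENNReal.tsum_comm]
  simp only [mul_assoc]

theorem expect_map (p : PMF α) (g : α → β) (F : β → ENNReal) :
    (p.map g).expect F = p.expect fun a => F (g a) := by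
  rw [← PMF.bind_pure_comp, expect_bind]
  simp [expect_pure]

theorem expect_mono (p : PMF α) {F F' : α → ENNReal} (h : ∀ a ∈ p.support, F a ≤ F' a) :
    p.expect F ≤ p.expect F' := by
  refine ENNReal.tsum_le_tsum fun a => ?_
  by_cases ha : p a = 0
  · simp [ha]
  · gcongr
    exact h a ((p.mem_support_iff a).2 ha)

theorem expect_const_mul (p : PMF α) (c : ENNReal) (F : α → ENNReal) :
    (p.expect fun a => c * F a) = c * p.expect F := by
  unfold expect
  rw [← ENNReal.tsum_mul_left]
  simp only [mul_left_comm]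

theorem expect_const (p : PMF α) (c : ENNReal) : (p.expect fun _ => c) = c := by
  unfold expect
  rw [ENNReal.tsum_mul_right, p.tsum_coe, one_mul]

theorem toOuterMeasure_le_expect (p : PMF α) (S : Set α) (F : α → ENNReal)
    (h : ∀ a ∈ p.support, a ∈ S → 1 ≤ F a) : p.toOuterMeasure S ≤ p.expect F := by
  rw [PMF.toOuterMeasure_apply]
  refine ENNReal.tsum_le_tsum fun a => ?_
  by_cases haS : a ∈ S
  · rw [Set.indicator_of_mem haS]
    by_cases ha : p a = 0
    · simp [ha]
    · exact le_mul_of_one_le_right' (h a ((p.mem_support_iff a).2 ha) haS)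
  · simp [haS]

theorem one_sub_toOuterMeasure_compl_le (p : PMF α) (S : Set α) :
    1 - p.toOuterMeasure Sᶜ ≤ p.toOuterMeasure S := by
  rw [tsub_le_iff_right]
  calc (1 : ENNReal) = p.toOuterMeasure Set.univ :=
        ((p.toOuterMeasure_apply_eq_one_iff _).2 (Set.subset_univ _)).symm
    _ = p.toOuterMeasure (S ∪ Sᶜ) := by rw [Set.union_compl_self]
    _ ≤ _ := MeasureTheory.measure_union_le _ _

end PMF

/-! ### Degrees under edge insertion -/

namespace Multigraph

variable {V : Type} [DecidableEq V]

theorem degree_cons (G : Multigraph V) (a b v : V) :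
    degree (s(a, b) ::ₘ G) v
      = degree G v + ((if v = a then 1 else 0) + if v = b then 1 else 0) := by
  unfold degree
  rw [Multiset.countP_cons, Multiset.count_cons]
  by_cases ha : v = a <;> by_cases hb : v = b
  · subst ha; subst hb; simp; ring
  · subst ha
    simp [hb]; ring
  · subst hb
    simp [ha]; ring
  · simp [ha, hb]

theorem degree_map {W : Type} [DecidableEq W] (G : Multigraph V) {g : V → W}
    (hg : Function.Injective g) (v : V) :
    degree (G.map (Sym2.map g) : Multigraph W) (g v) = degree G v := by
  induction G using Multiset.induction_on with
  | empty => simp [degree]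
  | cons e G ih =>
    induction e using Sym2.ind with
    | _ a b =>
      rw [Multiset.map_cons, Sym2.map_mk, degree_cons, degree_cons, ih]
      simp [hg.eq_iff]

variable [Fintype V]

theorem degreeSum_eq (G : Multigraph V) : G.degreeSum = 2 * G.card := by
  induction G using Multiset.induction_on with
  | empty => simp [degreeSum, degree]
  | cons e G ih =>
    induction e using Sym2.ind with
    | _ a b =>
      unfold degreeSum at *
      simp only [degree_cons, Finset.sum_add_distrib, ih, Multiset.card_cons]
      simp
      ring

theorem mem_support_attachEdge {u : V} {G H : Multigraph V}
    (h : H ∈ (attachEdge u G).support) : ∃ v, H = s(u, v) ::ₘ G := by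
  rw [attachEdge, PMF.mem_support_map_iff] at h
  obtain ⟨v, -, rfl⟩ := h
  exact ⟨v, rfl⟩

theorem mem_support_attachEdges {u : V} {G : Multigraph V} {k : ℕ} {H : Multigraph V}
    (h : H ∈ (attachEdges u k G).support) :
    H.card = G.card + k ∧ (∀ v, G.degree v ≤ H.degree v) ∧ k ≤ H.degree u := by
  induction k generalizing H with
  | zero =>
    rw [attachEdges, PMF.mem_support_pure_iff] at h
    subst h
    simp
  | succ k ih =>
    rw [attachEdges, PMF.mem_support_bind_iff] at h
    obtain ⟨H', h', h⟩ := h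
    obtain ⟨h1, h2, h3⟩ := ih h'
    obtain ⟨v, rfl⟩ := mem_support_attachEdge h
    refine ⟨?_, fun w => ?_, ?_⟩
    · rw [Multiset.card_cons, h1]; ring
    · rw [degree_cons]
      exact (h2 w).trans (Nat.le_add_right _ _)
    · rw [degree_cons, if_pos rfl]
      omega

/-! ### The potential and its contraction -/

/-- A decreasing function of the degree, of order `d ^ (-9/10)`, whose expectation contracts at
every edge insertion. -/
def degreePotential (d : ℕ) : ℝ := ∏ j ∈ Finset.range (d - 1), (1 - (9 / 10) / ((j : ℝ) + 1))

theorem degreePotential_factor_nonneg (j : ℕ) : 0 ≤ 1 - (9 / 10 : ℝ) / ((j : ℝ) + 1) := by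
  rw [sub_nonneg, div_le_one (by positivity)]
  have : (0 : ℝ) ≤ j := j.cast_nonneg
  linarith

theorem degreePotential_nonneg (d : ℕ) : 0 ≤ degreePotential d :=
  Finset.prod_nonneg fun j _ => degreePotential_factor_nonneg j

theorem degreePotential_le_one (d : ℕ) : degreePotential d ≤ 1 :=
  Finset.prod_le_one (fun j _ => degreePotential_factor_nonneg j) fun j _ => by
    have : 0 ≤ (9 / 10 : ℝ) / ((j : ℝ) + 1) := by positivity
    linarith

theorem degreePotential_succ {d : ℕ} (hd : 1 ≤ d) :
    degreePotential (d + 1) = degreePotential d * (1 - (9 / 10) / (d : ℝ)) := by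
  obtain ⟨k, rfl⟩ := Nat.exists_eq_add_of_le' hd
  simp [degreePotential, Finset.prod_range_succ]

theorem one_le_mul_degreePotential {d : ℕ} (hd : 1 ≤ d) : 1 ≤ 10 * (d : ℝ) * degreePotential d := by
  -- With d = k + 2 this is the stronger bound with d - 1 in place of d. It is an equality at d = 2,
  -- and the induction step needs only d - 1 ≤ d - 9/10.
  have key : ∀ k : ℕ, 1 ≤ 10 * ((k : ℝ) + 1) * degreePotential (k + 2) := by
    intro k
    induction k with
    | zero => norm_num [degreePotential]
    | succ k ih =>
      rw [degreePotential_succ (by omega)]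
      have hp := degreePotential_nonneg (k + 2)
      have h2 : ((k : ℝ) + 1) ≤ ((k + 1 : ℕ) + 1 : ℝ) * (1 - (9 / 10) / ((k + 2 : ℕ) : ℝ)) := by
        push_cast
        field_simp
        nlinarith
      calc (1 : ℝ) ≤ 10 * ((k : ℝ) + 1) * degreePotential (k + 2) := ih
        _ ≤ 10 * (((k + 1 : ℕ) + 1 : ℝ) * (1 - (9 / 10) / ((k + 2 : ℕ) : ℝ)))
              * degreePotential (k + 2) := by gcongr
        _ = _ := by ring
  rcases Nat.lt_or_ge d 2 with h | h
  · obtain rfl : d = 1 := by omega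
    norm_num [degreePotential]
  · obtain ⟨k, rfl⟩ := Nat.exists_eq_add_of_le' h
    refine (key k).trans ?_
    have := degreePotential_nonneg (k + 2)
    push_cast
    gcongr
    norm_num

theorem expect_attachEdge_le {u w : V} (hw : w ≠ u) {G : Multigraph V} (hd : 1 ≤ G.degree w)
    {K : ℝ} (hK : (G.degreeSum : ℝ) + 1 ≤ K) :
    (attachEdge u G).expect (fun H => ENNReal.ofReal (degreePotential (H.degree w)))
      ≤ ENNReal.ofReal (1 - (9 / 10) / K) * ENNReal.ofReal (degreePotential (G.degree w)) := by
  rw [attachEdge, PMF.expect_map]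
  set d := G.degree w with hd_def
  set M : ℝ := (G.degreeSum : ℝ) + 1 with hM
  have hM0 : 0 < M := by positivity
  have hd0 : (0 : ℝ) < d := by exact_mod_cast hd
  have hf := degreePotential_nonneg d
  have hs : degreePotential d
      = degreePotential (d + 1) + (9 / 10) / d * degreePotential d := by
    rw [degreePotential_succ hd]; ring
  have hprob : G.endpointLaw u w = ENNReal.ofReal (d / M) := by
    rw [endpointLaw, PMF.ofFintype_apply, if_neg hw, ENNReal.ofReal_div_of_pos hM0,
      ENNReal.ofReal_natCast, hM]
    congr 1
    rw [← ENNReal.ofReal_natCast]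
    push_cast
    rfl
  -- The potential drops only when `w` is the chosen endpoint. Adding the expected drop back,
  -- instead of subtracting it, avoids truncated subtraction in `ENNReal`.
  have htotal : (G.endpointLaw u).expect
        (fun v => ENNReal.ofReal (degreePotential (degree (s(u, v) ::ₘ G) w)))
      + ENNReal.ofReal (d / M) * ENNReal.ofReal ((9 / 10) / d * degreePotential d)
      = ENNReal.ofReal (degreePotential d) := by
    rw [← PMF.expect_const (G.endpointLaw u) (ENNReal.ofReal (degreePotential d))]
    unfold PMF.expect
    simp only [tsum_fintype]
    rw [← Finset.add_sum_erase _ _ (Finset.mem_univ w),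
      ← Finset.add_sum_erase Finset.univ
        (fun a => G.endpointLaw u a * ENNReal.ofReal (degreePotential d)) (Finset.mem_univ w),
      add_right_comm, hprob, ← mul_add]
    congr 1
    · rw [degree_cons, if_neg hw, if_pos rfl, zero_add, ← hd_def,
        ← ENNReal.ofReal_add (degreePotential_nonneg _) (by positivity), ← hs]
    · refine Finset.sum_congr rfl fun v hv => ?_
      rw [degree_cons, if_neg hw, if_neg (Finset.ne_of_mem_erase hv).symm, ← hd_def]
      rfl
  have hprod : d / M * ((9 / 10) / d * degreePotential d) = (9 / 10) / M * degreePotential d := by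
    field_simp
  rw [← ENNReal.ofReal_mul (by positivity), hprod] at htotal
  rw [ENNReal.eq_sub_of_add_eq ENNReal.ofReal_ne_top htotal,
    ← ENNReal.ofReal_sub _ (by positivity), ← ENNReal.ofReal_mul' hf]
  apply ENNReal.ofReal_le_ofReal
  have : (9 / 10) / K ≤ (9 / 10) / M := by gcongr
  nlinarith

/-- A single `K` serves all `k` insertions: just before the last one, the degree sum plus 1 is
2(card + k - 1) + 1, which is less than 2(card + k). -/
theorem expect_attachEdges_le {u w : V} (hw : w ≠ u) {G : Multigraph V} (hd : 1 ≤ G.degree w)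
    (k : ℕ) {K : ℝ} (hK : 2 * ((G.card : ℝ) + k) ≤ K) :
    (attachEdges u k G).expect (fun H => ENNReal.ofReal (degreePotential (H.degree w)))
      ≤ ENNReal.ofReal (1 - (9 / 10) / K) ^ k
        * ENNReal.ofReal (degreePotential (G.degree w)) := by
  induction k with
  | zero => simp [attachEdges, PMF.expect_pure]
  | succ k ih =>
    push_cast at hK
    rw [attachEdges, PMF.expect_bind, pow_succ', mul_assoc]
    refine le_trans ?_ (mul_le_mul_right (ih (by linarith)) _)
    rw [← PMF.expect_const_mul]
    refine PMF.expect_mono _ fun H hH => ?_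
    obtain ⟨h1, h2, -⟩ := mem_support_attachEdges hH
    refine expect_attachEdge_le hw (hd.trans (h2 w)) ?_
    rw [degreeSum_eq, h1]
    push_cast
    linarith

end Multigraph

/-! ### Decay of the potential along the process -/

open Multigraph

theorem mem_support_paGraph {m : ℕ} (hm : 1 ≤ m) (n : ℕ) {G : Multigraph (Fin n)}
    (h : G ∈ (paGraph m n).support) : G.card = m * n ∧ ∀ v, 1 ≤ G.degree v := by
  induction n with
  | zero =>
    rw [paGraph, PMF.mem_support_pure_iff] at h
    subst h
    exact ⟨by simp, fun v => v.elim0⟩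
  | succ n ih =>
    cases n with
    | zero =>
      rw [paGraph, PMF.mem_support_pure_iff] at h
      subst h
      refine ⟨by simp, fun v => ?_⟩
      obtain rfl : v = 0 := Fin.fin_one_eq_zero v
      simp only [degree, Multiset.count_replicate_self]
      omega
    | succ n =>
      rw [paGraph, PMF.mem_support_bind_iff] at h
      obtain ⟨H, hH, h⟩ := h
      obtain ⟨i1, i2⟩ := ih hH
      obtain ⟨h1, h2, h3⟩ := mem_support_attachEdges h
      refine ⟨?_, fun v => ?_⟩
      · rw [h1, Multiset.card_map, i1]; ring
      · induction v using Fin.lastCases with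
        | last => exact hm.trans h3
        | cast w =>
          refine le_trans ?_ (h2 _)
          rw [degree_map H (Fin.castSucc_injective _)]
          exact i2 w

/-- By 1 - y ≤ exp(-y) the left side is at most exp(-0.45/x), where `m` has cancelled, and log(1 +
1/x) ≤ 1/x finishes. The ratio x/(x+1) is chosen because it telescopes over time. -/
theorem one_sub_div_pow_le {m : ℕ} (hm : 1 ≤ m) {x : ℝ} (hx : 1 ≤ x) :
    (1 - (9 / 10) / (2 * (m * x))) ^ m ≤ (x / (x + 1)) ^ (0.45 : ℝ) := by
  have hm' : (1 : ℝ) ≤ m := by exact_mod_cast hm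
  have hx0 : 0 < x := by linarith
  have h0 : 0 ≤ 1 - (9 / 10 : ℝ) / (2 * (m * x)) := by
    rw [sub_nonneg, div_le_one (by positivity)]
    nlinarith
  have h1 : 1 - (9 / 10 : ℝ) / (2 * (m * x)) ≤ Real.exp (-((9 / 10) / (2 * (m * x)))) := by
    have := Real.add_one_le_exp (-((9 / 10 : ℝ) / (2 * (m * x))))
    linarith
  have h2 : -(1 / x) ≤ Real.log (x / (x + 1)) := by
    have h := Real.log_le_sub_one_of_pos (show 0 < (x + 1) / x by positivity)
    rw [← inv_div (x + 1) x, Real.log_inv]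
    have : (x + 1) / x - 1 = 1 / x := by field_simp; ring
    linarith
  calc (1 - (9 / 10) / (2 * (m * x))) ^ m
      ≤ Real.exp (-((9 / 10) / (2 * (m * x)))) ^ m := by gcongr
    _ = Real.exp (-(1 / x) * 0.45) := by
        rw [← Real.exp_nat_mul]
        congr 1
        field_simp
        norm_num
    _ ≤ Real.exp (Real.log (x / (x + 1)) * 0.45) := by gcongr
    _ = _ := (Real.rpow_def_of_pos (by positivity) _).symm

theorem expect_paGraph_degreePotential_le {m : ℕ} (hm : 1 ≤ m) (n : ℕ) (v : Fin n) :
    (paGraph m n).expect (fun G => ENNReal.ofReal (degreePotential (G.degree v)))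
      ≤ ENNReal.ofReal ((((v : ℕ) + 2 : ℝ) / (n + 1)) ^ (0.45 : ℝ)) := by
  have hone : ∀ (n : ℕ) (v : Fin n),
      (paGraph m n).expect (fun G => ENNReal.ofReal (degreePotential (G.degree v))) ≤ 1 := by
    intro n v
    rw [← PMF.expect_const (paGraph m n) 1]
    refine PMF.expect_mono _ fun G _ => ?_
    rw [ENNReal.ofReal_le_one]
    exact degreePotential_le_one _
  induction n with
  | zero => exact v.elim0
  | succ n ih =>
    induction v using Fin.lastCases with
    | last =>
      -- For the node that has just joined the ratio is 1, so the trivial bound suffices.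
      refine (hone _ _).trans (le_of_eq ?_)
      have : (((Fin.last n : Fin (n + 1)) : ℕ) + 2 : ℝ) / ((n + 1 : ℕ) + 1) = 1 := by
        rw [Fin.val_last]
        push_cast
        rw [div_eq_one_iff_eq (by positivity)]
        ring
      rw [this, Real.one_rpow, ENNReal.ofReal_one]
    | cast w =>
      cases n with
      | zero => exact w.elim0
      | succ n =>
        rw [paGraph, PMF.expect_bind]
        set x : ℝ := (n : ℝ) + 2 with hx
        have hx1 : 1 ≤ x := by
          have : (0 : ℝ) ≤ n := n.cast_nonneg
          linarith
        have step : ∀ G ∈ (paGraph m (n + 1)).support,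
            (attachEdges (Fin.last (n + 1)) m (G.map (Sym2.map Fin.castSucc))).expect
              (fun H => ENNReal.ofReal (degreePotential (H.degree w.castSucc)))
            ≤ ENNReal.ofReal ((x / (x + 1)) ^ (0.45 : ℝ))
              * ENNReal.ofReal (degreePotential (G.degree w)) := by
          intro G hG
          obtain ⟨h1, h2⟩ := mem_support_paGraph hm _ hG
          have hdeg := degree_map G (Fin.castSucc_injective _) w
          have hm' : (1 : ℝ) ≤ m := by exact_mod_cast hm
          have hbase : 0 ≤ 1 - (9 / 10 : ℝ) / (2 * (m * x)) := by
            rw [sub_nonneg, div_le_one (by positivity)]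
            nlinarith
          refine (expect_attachEdges_le (K := 2 * (m * x)) (Fin.castSucc_lt_last w).ne
            (hdeg ▸ h2 w) m ?_).trans ?_
          · rw [Multiset.card_map, h1, hx]
            push_cast
            apply le_of_eq
            ring
          · rw [hdeg, ← ENNReal.ofReal_pow hbase]
            gcongr
            exact one_sub_div_pow_le hm hx1
        refine (PMF.expect_mono _ step).trans ?_
        rw [PMF.expect_const_mul]
        refine (mul_le_mul_right (ih w) _).trans (le_of_eq ?_)
        rw [← ENNReal.ofReal_mul (by positivity), ← Real.mul_rpow (by positivity) (by positivity)]
        congr 2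
        rw [Fin.val_castSucc, hx]
        push_cast
        field_simp
        ring

/-- Markov's inequality: a degree d with 1 ≤ d < L forces 10 * L * f(d) ≥ 1. -/
theorem paGraph_degree_lt_le {m : ℕ} (hm : 1 ≤ m) (n : ℕ) (v : Fin n) {L : ℝ} (hL : 0 ≤ L) :
    (paGraph m n).toOuterMeasure {G | (G.degree v : ℝ) < L}
      ≤ ENNReal.ofReal (10 * L * (((v : ℕ) + 2 : ℝ) / (n + 1)) ^ (0.45 : ℝ)) := by
  rw [ENNReal.ofReal_mul (by positivity)]
  refine le_trans ?_ (mul_le_mul_right (expect_paGraph_degreePotential_le hm n v) _)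
  rw [← PMF.expect_const_mul]
  refine PMF.toOuterMeasure_le_expect _ _ _ fun G hG hlt => ?_
  rw [← ENNReal.ofReal_mul (by positivity), ENNReal.one_le_ofReal]
  refine (one_le_mul_degreePotential ((mem_support_paGraph hm n hG).2 v)).trans ?_
  have := degreePotential_nonneg (G.degree v)
  have : (G.degree v : ℝ) ≤ L := le_of_lt hlt
  gcongr

/-! ### Union bound over the early nodes -/

theorem paGraph_exists_degree_lt_le {m : ℕ} (hm : 1 ≤ m) {n : ℕ} (hn : 1 ≤ n) :
    (paGraph m n).toOuterMeasure
        {G : Multigraph (Fin n) | ∀ v : Fin n, (joinTime v : ℝ) < (n : ℝ) ^ (0.3 : ℝ) →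
          Real.log (n : ℝ) ^ 3 ≤ (G.degree v : ℝ)}ᶜ
      ≤ ENNReal.ofReal (20 * (Real.log n ^ 3 * (n : ℝ) ^ (-0.015 : ℝ))) := by
  set N : ℝ := (n : ℝ) ^ (0.3 : ℝ) with hN
  set L : ℝ := Real.log n ^ 3 with hLdef
  have hn' : (1 : ℝ) ≤ n := by exact_mod_cast hn
  have hn0 : (0 : ℝ) < n := by linarith
  have hN0 : 0 ≤ N := by positivity
  have hL : 0 ≤ L := pow_nonneg (Real.log_nonneg hn') 3
  set s : Finset (Fin n) := Finset.univ.filter fun v => (joinTime v : ℝ) < N with hs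
  have hcard : (s.card : ℝ) ≤ N := by
    have h : s.card ≤ (Finset.range ⌊N⌋₊).card := by
      refine Finset.card_le_card_of_injOn (fun v => (v : ℕ)) (fun v hv => ?_)
        (Fin.val_injective.injOn)
      have hv' : (joinTime v : ℝ) < N := (Finset.mem_filter.1 hv).2
      exact Finset.mem_coe.2 (Finset.mem_range.2 (Nat.le_floor hv'.le))
    rw [Finset.card_range] at h
    exact (Nat.cast_le.2 h).trans (Nat.floor_le hN0)
  have hsub : {G : Multigraph (Fin n) | ∀ v : Fin n, (joinTime v : ℝ) < N →
          L ≤ (G.degree v : ℝ)}ᶜ ⊆ ⋃ v ∈ s, {G | (G.degree v : ℝ) < L} := by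
    intro G hG
    simp only [Set.mem_compl_iff, Set.mem_ofPred_eq, not_forall, not_le] at hG
    obtain ⟨v, hv, hlt⟩ := hG
    exact Set.mem_biUnion (Finset.mem_filter.2 ⟨Finset.mem_univ v, hv⟩) hlt
  have hbound : ∀ v ∈ s, (paGraph m n).toOuterMeasure {G | (G.degree v : ℝ) < L}
      ≤ ENNReal.ofReal (20 * L * (n : ℝ) ^ (-0.315 : ℝ)) := by
    intro v hv
    refine (paGraph_degree_lt_le hm n v hL).trans (ENNReal.ofReal_le_ofReal ?_)
    have hv' : ((v : ℕ) : ℝ) + 1 < N := by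
      have : (joinTime v : ℝ) < N := (Finset.mem_filter.1 hv).2
      simpa [joinTime] using this
    have hv0 : (0 : ℝ) ≤ ((v : ℕ) : ℝ) := Nat.cast_nonneg _
    -- Here v + 2 ≤ 2(v + 1) < 2N and N/n = n^(-0.7). The power 0.45 then gives the exponent -0.315.
    have h1 : (((v : ℕ) + 2 : ℝ) / (n + 1)) ≤ 2 * (n : ℝ) ^ (-0.7 : ℝ) := by
      calc (((v : ℕ) + 2 : ℝ) / (n + 1)) ≤ 2 * N / n := by
            gcongr
            · linarith
            · linarith
        _ = 2 * (n : ℝ) ^ (-0.7 : ℝ) := by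
            rw [hN, mul_div_assoc, ← Real.rpow_sub_one hn0.ne']
            norm_num
    have h2 : (2 : ℝ) ^ (0.45 : ℝ) ≤ 2 := by
      calc (2 : ℝ) ^ (0.45 : ℝ) ≤ 2 ^ (1 : ℝ) :=
            Real.rpow_le_rpow_of_exponent_le (by norm_num) (by norm_num)
        _ = 2 := Real.rpow_one 2
    calc 10 * L * (((v : ℕ) + 2 : ℝ) / (n + 1)) ^ (0.45 : ℝ)
        ≤ 10 * L * (2 * (n : ℝ) ^ (-0.7 : ℝ)) ^ (0.45 : ℝ) := by gcongr
      _ = 10 * L * ((2 : ℝ) ^ (0.45 : ℝ) * (n : ℝ) ^ (-0.315 : ℝ)) := by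
          rw [Real.mul_rpow (by norm_num) (by positivity), ← Real.rpow_mul hn0.le]
          norm_num
      _ ≤ 10 * L * (2 * (n : ℝ) ^ (-0.315 : ℝ)) := by gcongr
      _ = _ := by ring
  calc _ ≤ (paGraph m n).toOuterMeasure (⋃ v ∈ s, {G | (G.degree v : ℝ) < L}) :=
        MeasureTheory.measure_mono hsub
    _ ≤ ∑ v ∈ s, (paGraph m n).toOuterMeasure {G | (G.degree v : ℝ) < L} :=
        MeasureTheory.measure_biUnion_finset_le _ _
    _ ≤ ∑ _v ∈ s, ENNReal.ofReal (20 * L * (n : ℝ) ^ (-0.315 : ℝ)) := Finset.sum_le_sum hbound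
    _ = ENNReal.ofReal (s.card * (20 * L * (n : ℝ) ^ (-0.315 : ℝ))) := by
        rw [Finset.sum_const, nsmul_eq_mul, ENNReal.ofReal_mul s.card.cast_nonneg,
          ENNReal.ofReal_natCast]
    _ ≤ ENNReal.ofReal (N * (20 * L * (n : ℝ) ^ (-0.315 : ℝ))) := by gcongr
    _ = ENNReal.ofReal (20 * (L * (n : ℝ) ^ (-0.015 : ℝ))) := by
        congr 1
        rw [show (-0.015 : ℝ) = 0.3 + -0.315 by norm_num, Real.rpow_add hn0, hN]
        ring

theorem tendsto_log_pow_mul_rpow_neg (k : ℕ) {a : ℝ} (ha : 0 < a) :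
    Tendsto (fun n : ℕ => Real.log (n : ℝ) ^ k * (n : ℝ) ^ (-a)) atTop (𝓝 0) := by
  have h := (isLittleO_log_rpow_rpow_atTop (k : ℝ) ha).tendsto_div_nhds_zero
  refine (h.comp tendsto_natCast_atTop_atTop).congr fun n => ?_
  simp only [Function.comp_apply]
  rw [Real.rpow_natCast, Real.rpow_neg n.cast_nonneg, div_eq_mul_inv]

end

theorem mainTheorem7 (m : ℕ) (hm : 1 ≤ m) :
    Tendsto
      (fun n : ℕ => (paGraph m n).toOuterMeasure
        {G : Multigraph (Fin n) | ∀ v : Fin n, (joinTime v : ℝ) < (n : ℝ) ^ (0.3 : ℝ) →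
          Real.log (n : ℝ) ^ 3 ≤ (G.degree v : ℝ)})
      atTop (𝓝 1) := by
  have herr : Tendsto
      (fun n : ℕ => 1 - ENNReal.ofReal (20 * (Real.log n ^ 3 * (n : ℝ) ^ (-0.015 : ℝ))))
      atTop (𝓝 1) := by
    have h := (tendsto_log_pow_mul_rpow_neg 3 (show (0 : ℝ) < 0.015 by norm_num)).const_mul 20
    rw [mul_zero] at h
    simpa using ENNReal.Tendsto.sub (tendsto_const_nhds (x := (1 : ENNReal)))
      (ENNReal.tendsto_ofReal h) (Or.inl ENNReal.one_ne_top)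
  refine tendsto_of_tendsto_of_tendsto_of_le_of_le' herr tendsto_const_nhds ?_ ?_
  · filter_upwards [eventually_ge_atTop 1] with n hn
    exact (tsub_le_tsub_left (paGraph_exists_degree_lt_le hm hn) 1).trans
      (PMF.one_sub_toOuterMeasure_compl_le _ _)
  · refine Eventually.of_forall fun n => ?_
    calc _ ≤ (paGraph m n).toOuterMeasure Set.univ :=
          MeasureTheory.measure_mono (Set.subset_univ _)
      _ = 1 := ((paGraph m n).toOuterMeasure_apply_eq_one_iff _).2 (Set.subset_univ _)
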